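/- Let $J\ge 0$ and let $\mathbb R^J$ carry the Euclidean inner product $\langle\cdot,\cdot\rangle$ and norm $\|\cdot\|$. For $g:\mathbb R^J\to\,]-\infty,+\infty]$ put $\operatorname{dom} g=\{x: g(x)\in\mathbb R\}$ and let $\partial g(x)=\{u: \forall h\in\mathbb R^J,\ g(x)+\langle h,u\rangle\le g(x+h)\}$ for $x\in\operatorname{dom} g$ and $\partial g(x)=\varnothing$ otherwise. Let $f:\mathbb R^J\to\,]-\infty,+\infty]$ be a convex function of Legendre type, that is: $f$ is convex; $f$ is differentiable on $U:=\operatorname{int}\operatorname{dom} f$ and $\|\nabla f(x)\|\to+\infty$ whenever $x\in U$ approaches a boundary point of $\operatorname{dom} f$; and $f$ is strictly convex on every convex subset of $\{x:\partial f(x)\ne\varnothing\}$. The Bregman distance of $f$ is $$D(x,y)=\begin{cases} f(x)-f(y)-\langle\nabla f(y),x-y\rangle, & y\in U,\\ +\infty, & y\notin U.\end{cases}$$ For a nonempty set $S\subseteq U$ define the farthest-point map $\Phi_S$ by $$\Phi_S(x)=\Big\{c\in S:\ D(x,c)=\sup_{s\in S}D(x,s)\Big\}\ \text{ if } x\in\operatorname{dom}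 f,\qquad \Phi_S(x)=\varnothing\ \text{ otherwise},$$ let $\operatorname{dom}\Phi_S=\{x:\Phi_S(x)\neq\varnothing\}$, and call $S$ *$D$-Klee* if $\Phi_S(x)$ is a singleton for every $x\in U$. Let $C$ be a nonempty subset of $U$ such that the closure $\overline C$ is a compact subset of $U$ and $U\subseteq\operatorname{dom}\Phi_C$. Then $\overline C$ is $D$-Klee if and only if $C$ is $D$-Klee and $\Phi_C$, regarded as a point-valued map on $U$, is continuous on $U$. -/

import Mathlib

open Set Filter Topology

namespace BregmanKlee

noncomputable section

/-- The (essential) domain of an extended-real-valued function: the points where it is real. -/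
def edom {J : ℕ} (g : EuclideanSpace ℝ (Fin J) → EReal) : Set (EuclideanSpace ℝ (Fin J)) :=
  {x | g x ≠ ⊥ ∧ g x ≠ ⊤}

/-- The interior of the domain. -/
def intDom {J : ℕ} (g : EuclideanSpace ℝ (Fin J) → EReal) : Set (EuclideanSpace ℝ (Fin J)) :=
  interior (edom g)

/-- Convexity of a function with values in `]-∞, +∞]`. -/
def IsConvex {J : ℕ} (g : EuclideanSpace ℝ (Fin J) → EReal) : Prop :=
  (∀ x, g x ≠ ⊥) ∧
  ∀ x y : EuclideanSpace ℝ (Fin J), ∀ a b : ℝ, 0 < a → 0 < b → a + b = 1 →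
    g (a • x + b • y) ≤ (a : EReal) * g x + (b : EReal) * g y

/-- The subdifferential `∂g(x)`; it is empty outside the domain of `g`. -/
def subdiff {J : ℕ} (g : EuclideanSpace ℝ (Fin J) → EReal) (x : EuclideanSpace ℝ (Fin J)) :
    Set (EuclideanSpace ℝ (Fin J)) :=
  {u | x ∈ edom g ∧
    ∀ h : EuclideanSpace ℝ (Fin J), g x + ((inner ℝ h u : ℝ) : EReal) ≤ g (x + h)}

/-- The domain `{x | A x ≠ ∅}` of a set-valued operator. -/
def svDom {J : ℕ} (A : EuclideanSpace ℝ (Fin J) → Set (EuclideanSpace ℝ (Fin J))) :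
    Set (EuclideanSpace ℝ (Fin J)) :=
  {x | (A x).Nonempty}

/-- The gradient of an extended-real-valued function. It is only used in the interior of the
domain, where `g` coincides with its real part on a neighbourhood. -/
def egrad {J : ℕ} (g : EuclideanSpace ℝ (Fin J) → EReal) (x : EuclideanSpace ℝ (Fin J)) :
    EuclideanSpace ℝ (Fin J) :=
  gradient (fun z => (g z).toReal) x

/-- Essential smoothness: differentiable on the interior of the domain, and the norm of the
gradient blows up at every boundary point of the domain. -/
def EssentiallySmooth {J : ℕ} (g : EuclideanSpace ℝ (Fin J) → EReal) : Prop :=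
  (∀ x ∈ intDom g, DifferentiableAt ℝ (fun z => (g z).toReal) x) ∧
  ∀ z ∈ frontier (edom g), Tendsto (fun x => ‖egrad g x‖) (𝓝[intDom g] z) atTop

/-- Essential strict convexity: strictly convex on every convex subset of `dom ∂g`. -/
def EssentiallyStrictlyConvex {J : ℕ} (g : EuclideanSpace ℝ (Fin J) → EReal) : Prop :=
  ∀ S : Set (EuclideanSpace ℝ (Fin J)), Convex ℝ S → S ⊆ svDom (subdiff g) →
    StrictConvexOn ℝ S (fun z => (g z).toReal)

/-- Convex functions of Legendre type. -/
structure IsLegendre {J : ℕ} (f : EuclideanSpace ℝ (Fin J) → EReal) : Prop where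
  convex : IsConvex f
  smooth : EssentiallySmooth f
  strict : EssentiallyStrictlyConvex f

open Classical in
/-- The Bregman distance `D(x, y)` with respect to `f`. -/
def bregman {J : ℕ} (f : EuclideanSpace ℝ (Fin J) → EReal) (x y : EuclideanSpace ℝ (Fin J)) :
    EReal :=
  if y ∈ intDom f then f x - f y - ((inner ℝ (egrad f y) (x - y) : ℝ) : EReal) else ⊤

/-- The right Bregman farthest-distance function `x ↦ sup_{c ∈ C} D(x, c)`. -/
def farDist {J : ℕ} (f : EuclideanSpace ℝ (Fin J) → EReal) (C : Set (EuclideanSpace ℝ (Fin J)))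
    (x : EuclideanSpace ℝ (Fin J)) : EReal :=
  ⨆ c ∈ C, bregman f x c

/-- The right Bregman farthest-point map; it is empty outside the domain of `f`. -/
def farMap {J : ℕ} (f : EuclideanSpace ℝ (Fin J) → EReal) (C : Set (EuclideanSpace ℝ (Fin J)))
    (x : EuclideanSpace ℝ (Fin J)) : Set (EuclideanSpace ℝ (Fin J)) :=
  {c | x ∈ edom f ∧ c ∈ C ∧ bregman f x c = farDist f C x}

/-- `C` is D-Klee: every point of the interior of `dom f` has exactly one farthest point. -/
def IsKlee {J : ℕ} (f : EuclideanSpace ℝ (Fin J) → EReal)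
    (C : Set (EuclideanSpace ℝ (Fin J))) : Prop :=
  ∀ x ∈ intDom f, ∃ c, farMap f C x = {c}

/-- A set-valued operator that is single-valued on `S` is continuous on `S` when the
corresponding point-valued map is. -/
def SVContinuousOn {J : ℕ} (A : EuclideanSpace ℝ (Fin J) → Set (EuclideanSpace ℝ (Fin J)))
    (S : Set (EuclideanSpace ℝ (Fin J))) : Prop :=
  ∃ φ : EuclideanSpace ℝ (Fin J) → EuclideanSpace ℝ (Fin J),
    (∀ x ∈ S, A x = {φ x}) ∧ ContinuousOn φ S

end

end BregmanKlee

/-!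
Write `G` for the gradient of `f` on `U = int dom f`. For `x, c ∈ U` the Bregman distance is the
real number `f x - f c - ⟪G c, x - c⟫`, so, up to the term `f x`, the function `x ↦ D(x, c)` is
affine with slope `-G c`, and the farthest distance is `f` plus a convex function having `-G c` as a
subgradient at `x` for each farthest point `c` of `x`.

The gradient of a differentiable convex function is continuous
(`ConvexOn.continuousOn_gradient`), so `D` is jointly continuous on `U × U`. Hence a farthest point
in `C` is also farthest in `closure C`, and by compactness a farthest-point map that is single-valued
on `closure C` is continuous (`IsLegendre.continuousOn_of_unique_farthest`): this is the forward direction.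

Conversely, let `φ` be a continuous selection of farthest points, let `c` be a farthest point of `x`
in `closure C`, and put `h = G (φ x) - G c`. Monotonicity of the subdifferential, applied at `x` and
`x + t • h`, gives `⟪G (φ (x + t • h)) - G c, h⟫ ≤ 0` for small `t > 0`. Letting `t → 0` yields
`‖h‖² ≤ 0` (`IsLegendre.gradient_eq_of_farthest`). Strict convexity makes `G` injective on `U`
(`StrictConvexOn.injOn_gradient`), and so `c = φ x`.
-/

/-! ### Gradients of convex functions -/

section ConvexGradient

variable {E : Type*} [NormedAddCommGroup E] [InnerProductSpace ℝ E] [CompleteSpace E]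

theorem hasDerivAt_line_of_differentiableAt {r : E → ℝ} {x : E}
    (hr : DifferentiableAt ℝ r x) (e : E) :
    HasDerivAt (fun t : ℝ => r (x + t • e)) (inner ℝ (gradient r x) e) 0 := by
  have h1 : HasFDerivAt r (InnerProductSpace.toDual ℝ E (gradient r x)) (x + (0 : ℝ) • e) := by
    simpa using hr.hasGradientAt.hasFDerivAt
  have h2 : HasDerivAt (fun t : ℝ => x + t • e) e 0 := by
    simpa using ((hasDerivAt_id (0 : ℝ)).smul_const e).const_add x
  have h3 := h1.comp_hasDerivAt (0 : ℝ) h2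
  rwa [InnerProductSpace.toDual_apply_apply] at h3

theorem ConvexOn.add_inner_gradient_le {r : E → ℝ} {S : Set E} (hc : ConvexOn ℝ S r) {x y : E}
    (hx : x ∈ S) (hy : y ∈ S) (hr : DifferentiableAt ℝ r x) :
    r x + inner ℝ (gradient r x) (y - x) ≤ r y := by
  have hline := hc.comp_affineMap (AffineMap.lineMap (k := ℝ) x y)
  have hd : HasDerivAt (r ∘ AffineMap.lineMap (k := ℝ) x y)
      (inner ℝ (gradient r x) (y - x)) 0 := by
    refine (hasDerivAt_line_of_differentiableAt hr (y - x)).congr_of_eventuallyEq (.of_forall fun t => ?_)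
    simp [AffineMap.lineMap_apply, add_comm]
  have := hline.le_slope_of_hasDerivAt (x := 0) (y := 1) (by simpa using hx) (by simpa using hy)
    one_pos hd
  simp only [slope_def_field, Function.comp_apply, AffineMap.lineMap_apply_zero,
    AffineMap.lineMap_apply_one, sub_zero, div_one] at this
  linarith

/-- The directional derivatives of a convex function are upper semicontinuous, since each is an
infimum of difference quotients, which are continuous. -/
theorem ConvexOn.eventually_inner_gradient_lt {r : E → ℝ} {S : Set E} (hc : ConvexOn ℝ S r)
    (hS : IsOpen S) (hr : ∀ x ∈ S, DifferentiableAt ℝ r x) {y : E} (hy : y ∈ S) (e : E) {a : ℝ}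
    (ha : inner ℝ (gradient r y) e < a) :
    ∀ᶠ y' in 𝓝 y, inner ℝ (gradient r y') e < a := by
  have hslope := (hasDerivAt_line_of_differentiableAt (hr y hy) e).tendsto_slope_zero_right
  have hline : Tendsto (fun t : ℝ => y + t • e) (𝓝[>] 0) (𝓝 y) := by
    have : Continuous fun t : ℝ => y + t • e := by fun_prop
    simpa using (this.tendsto 0).mono_left nhdsWithin_le_nhds
  obtain ⟨t, ht, htS, ht0⟩ := ((hslope.eventually_lt_const ha).and
    ((hline.eventually (hS.mem_nhds hy)).and self_mem_nhdsWithin)).exists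
  replace ht0 : 0 < t := ht0
  simp only [zero_add, zero_smul, add_zero, smul_eq_mul] at ht
  have hshift : ContinuousAt (fun y' => y' + t • e) y := by fun_prop
  have hquot : ContinuousAt (fun y' => t⁻¹ * (r (y' + t • e) - r y')) y := by
    refine continuousAt_const.mul (ContinuousAt.sub ?_ (hr y hy).continuousAt)
    exact ContinuousAt.comp (f := fun y' => y' + t • e) (hr _ htS).continuousAt hshift
  filter_upwards [hquot.eventually_lt_const ht, hS.mem_nhds hy,
    hshift.eventually (hS.mem_nhds htS)] with y' h1 h2 h3
  refine lt_of_le_of_lt ?_ h1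
  have h4 := hc.add_inner_gradient_le h2 h3 (hr y' h2)
  rw [add_sub_cancel_left, inner_smul_right] at h4
  rw [inv_mul_eq_div, le_div_iff₀ ht0]
  linarith

theorem ConvexOn.continuousOn_gradient [FiniteDimensional ℝ E] {r : E → ℝ} {S : Set E}
    (hc : ConvexOn ℝ S r) (hS : IsOpen S) (hr : ∀ x ∈ S, DifferentiableAt ℝ r x) :
    ContinuousOn (gradient r) S := by
  intro y hy
  refine ContinuousAt.continuousWithinAt ?_
  have hdir : ∀ e : E, Tendsto (fun y' => inner ℝ e (gradient r y')) (𝓝 y)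
      (𝓝 (inner ℝ e (gradient r y))) := by
    intro e
    simp only [real_inner_comm _ e]
    refine tendsto_order.2 ⟨fun a ha => ?_, fun a ha =>
      hc.eventually_inner_gradient_lt hS hr hy e ha⟩
    have := hc.eventually_inner_gradient_lt hS hr hy (-e) (a := -a) (by
      rw [inner_neg_right]; linarith)
    filter_upwards [this] with y' h
    rw [inner_neg_right] at h
    linarith
  let b := stdOrthonormalBasis ℝ E
  have hsum : Tendsto (fun y' => ∑ i, inner ℝ (b i) (gradient r y') • b i) (𝓝 y)
      (𝓝 (∑ i, inner ℝ (b i) (gradient r y) • b i)) :=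
    tendsto_finsetSum _ fun i _ => (hdir (b i)).smul_const (b i)
  simp only [b.sum_repr'] at hsum
  exact hsum

theorem StrictConvexOn.injOn_gradient {r : E → ℝ} {S : Set E} (hc : StrictConvexOn ℝ S r)
    (hr : ∀ x ∈ S, DifferentiableAt ℝ r x) : Set.InjOn (gradient r) S := by
  intro a ha b hb hab
  by_contra hne
  have h1 := hc.convexOn.add_inner_gradient_le hb ha (hr b hb)
  have hmid : (1 / 2 : ℝ) • a + (1 / 2 : ℝ) • b ∈ S :=
    hc.1 ha hb (by norm_num) (by norm_num) (by norm_num)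
  have h2 := hc.convexOn.add_inner_gradient_le ha hmid (hr a ha)
  have h3 := hc.2 ha hb hne (show (0 : ℝ) < 1 / 2 by norm_num)
    (show (0 : ℝ) < 1 / 2 by norm_num) (by norm_num)
  have h4 : (1 / 2 : ℝ) • a + (1 / 2 : ℝ) • b - a = (-(1 / 2) : ℝ) • (a - b) := by module
  rw [h4, inner_smul_right, hab] at h2
  simp only [smul_eq_mul] at h3
  linarith

end ConvexGradient

namespace BregmanKlee

variable {J : ℕ} {f : EuclideanSpace ℝ (Fin J) → EReal}

/-! ### The real part of a Legendre function -/

theorem isOpen_intDom : IsOpen (intDom f) := isOpen_interior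

theorem IsConvex.convexOn_toReal (hf : IsConvex f) :
    ConvexOn ℝ (edom f) (fun z => (f z).toReal) := by
  have key : ∀ x ∈ edom f, ∀ y ∈ edom f, ∀ a b : ℝ, 0 < a → 0 < b → a + b = 1 →
      f (a • x + b • y) ≤ ((a * (f x).toReal + b * (f y).toReal : ℝ) : EReal) := by
    intro x hx y hy a b ha hb hab
    have h := hf.2 x y a b ha hb hab
    rwa [← EReal.coe_toReal hx.2 hx.1, ← EReal.coe_toReal hy.2 hy.1, ← EReal.coe_mul,
      ← EReal.coe_mul, ← EReal.coe_add] at h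
  refine convexOn_iff_forall_pos.2 ⟨?_, ?_⟩
  · refine convex_iff_forall_pos.2 fun x hx y hy a b ha hb hab => ⟨hf.1 _, ?_⟩
    exact ((key x hx y hy a b ha hb hab).trans_lt (EReal.coe_lt_top _)).ne
  · intro x hx y hy a b ha hb hab
    have h := key x hx y hy a b ha hb hab
    have h' := EReal.toReal_le_toReal h (hf.1 _) (EReal.coe_ne_top _)
    rwa [EReal.toReal_coe] at h'

theorem IsLegendre.convexOn_intDom (hf : IsLegendre f) :
    ConvexOn ℝ (intDom f) (fun z => (f z).toReal) :=
  hf.convex.convexOn_toReal.subset interior_subset hf.convex.convexOn_toReal.1.interior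

theorem IsLegendre.continuousOn_egrad (hf : IsLegendre f) : ContinuousOn (egrad f) (intDom f) :=
  hf.convexOn_intDom.continuousOn_gradient isOpen_intDom hf.smooth.1

/-- At an interior point of the domain the gradient is a subgradient, so essential strict convexity
applies to the whole interior. -/
theorem IsLegendre.strictConvexOn_intDom (hf : IsLegendre f) :
    StrictConvexOn ℝ (intDom f) (fun z => (f z).toReal) := by
  refine hf.strict _ hf.convexOn_intDom.1 fun x hx => ⟨egrad f x, interior_subset hx, fun h => ?_⟩
  have hxe : x ∈ edom f := interior_subset hx
  by_cases htop : f (x + h) = ⊤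
  · rw [htop]
    exact le_top
  · have hy : x + h ∈ edom f := ⟨hf.convex.1 _, htop⟩
    have hle := hf.convex.convexOn_toReal.add_inner_gradient_le hxe hy (hf.smooth.1 x hx)
    rw [add_sub_cancel_left, real_inner_comm] at hle
    rw [← EReal.coe_toReal hxe.2 hxe.1, ← EReal.coe_toReal hy.2 hy.1, ← EReal.coe_add]
    exact EReal.coe_le_coe_iff.2 hle

theorem IsLegendre.injOn_egrad (hf : IsLegendre f) : InjOn (egrad f) (intDom f) :=
  hf.strictConvexOn_intDom.injOn_gradient hf.smooth.1

/-! ### The Bregman distance as a real function -/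

/-- The real-valued Bregman distance. It agrees with `bregman` when both arguments lie in the
interior of the domain of `f`, and is a junk value elsewhere. -/
noncomputable def bregmanReal (f : EuclideanSpace ℝ (Fin J) → EReal)
    (x y : EuclideanSpace ℝ (Fin J)) : ℝ :=
  (f x).toReal - (f y).toReal - inner ℝ (egrad f y) (x - y)

theorem bregman_eq_coe {x y : EuclideanSpace ℝ (Fin J)} (hx : x ∈ intDom f) (hy : y ∈ intDom f) :
    bregman f x y = (bregmanReal f x y : EReal) := by
  have hxe : x ∈ edom f := interior_subset hx
  have hye : y ∈ edom f := interior_subset hy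
  rw [bregman, if_pos hy, bregmanReal, EReal.coe_sub, EReal.coe_sub,
    EReal.coe_toReal hxe.2 hxe.1, EReal.coe_toReal hye.2 hye.1]

theorem IsLegendre.continuousAt_bregmanReal (hf : IsLegendre f) {x y : EuclideanSpace ℝ (Fin J)}
    (hx : x ∈ intDom f) (hy : y ∈ intDom f) :
    ContinuousAt (fun p : EuclideanSpace ℝ (Fin J) × EuclideanSpace ℝ (Fin J) =>
      bregmanReal f p.1 p.2) (x, y) := by
  have h1 : ContinuousAt (fun p : EuclideanSpace ℝ (Fin J) × EuclideanSpace ℝ (Fin J) =>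
      (f p.1).toReal) (x, y) :=
    ContinuousAt.comp (g := fun z => (f z).toReal) (hf.smooth.1 x hx).continuousAt
      continuousAt_fst
  have h2 : ContinuousAt (fun p : EuclideanSpace ℝ (Fin J) × EuclideanSpace ℝ (Fin J) =>
      (f p.2).toReal) (x, y) :=
    ContinuousAt.comp (g := fun z => (f z).toReal) (hf.smooth.1 y hy).continuousAt
      continuousAt_snd
  have h3 : ContinuousAt (fun p : EuclideanSpace ℝ (Fin J) × EuclideanSpace ℝ (Fin J) =>
      egrad f p.2) (x, y) :=
    ContinuousAt.comp (g := egrad f)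
      (hf.continuousOn_egrad.continuousAt (isOpen_intDom.mem_nhds hy)) continuousAt_snd
  exact (h1.sub h2).sub (Filter.Tendsto.inner h3 (continuousAt_fst.sub continuousAt_snd))

/-! ### Farthest points -/

theorem mem_farMap_iff {S : Set (EuclideanSpace ℝ (Fin J))} (hS : S ⊆ intDom f)
    {x c : EuclideanSpace ℝ (Fin J)} (hx : x ∈ intDom f) :
    c ∈ farMap f S x ↔ c ∈ S ∧ ∀ s ∈ S, bregmanReal f x s ≤ bregmanReal f x c := by
  refine ⟨fun ⟨_, hc, h⟩ => ⟨hc, fun s hs => ?_⟩, fun ⟨hc, h⟩ => ⟨interior_subset hx, hc, ?_⟩⟩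
  · rw [← EReal.coe_le_coe_iff, ← bregman_eq_coe hx (hS hs), ← bregman_eq_coe hx (hS hc), h]
    exact le_iSup₂ (f := fun c _ => bregman f x c) s hs
  · refine le_antisymm (le_iSup₂ (f := fun c _ => bregman f x c) c hc) (iSup₂_le fun s hs => ?_)
    rw [bregman_eq_coe hx (hS hs), bregman_eq_coe hx (hS hc)]
    exact EReal.coe_le_coe_iff.2 (h s hs)

theorem IsLegendre.farMap_subset_farMap_closure (hf : IsLegendre f)
    {C : Set (EuclideanSpace ℝ (Fin J))} (hC : closure C ⊆ intDom f)
    {x : EuclideanSpace ℝ (Fin J)} (hx : x ∈ intDom f) :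
    farMap f C x ⊆ farMap f (closure C) x := by
  intro c hc
  rw [mem_farMap_iff (subset_closure.trans hC) hx] at hc
  refine (mem_farMap_iff hC hx).2 ⟨subset_closure hc.1, fun s hs => ?_⟩
  have hcont : ContinuousAt (fun s => bregmanReal f x s) s :=
    ContinuousAt.comp (f := fun s => (x, s)) (hf.continuousAt_bregmanReal hx (hC hs))
      (by fun_prop)
  exact ContinuousWithinAt.closure_le hs hcont.continuousWithinAt continuousWithinAt_const hc.2

/-- By compactness it suffices to identify the cluster points of `φ` at `x`; joint continuity of the
Bregman distance shows that each of them is a farthest point of `x`. -/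
theorem IsLegendre.continuousOn_of_unique_farthest (hf : IsLegendre f)
    {K : Set (EuclideanSpace ℝ (Fin J))} (hK : IsCompact K) (hKU : K ⊆ intDom f)
    {φ : EuclideanSpace ℝ (Fin J) → EuclideanSpace ℝ (Fin J)}
    (hφ : ∀ x ∈ intDom f, farMap f K x = {φ x}) : ContinuousOn φ (intDom f) := by
  have hmem : ∀ x ∈ intDom f, φ x ∈ K ∧ ∀ s ∈ K, bregmanReal f x s ≤ bregmanReal f x (φ x) :=
    fun x hx => (mem_farMap_iff hKU hx).1 (by rw [hφ x hx]; exact mem_singleton _)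
  intro x hx
  refine hK.tendsto_nhds_of_unique_mapClusterPt
    (eventually_nhdsWithin_of_forall fun z hz => (hmem z hz).1) fun c hc hcl => ?_
  suffices c ∈ farMap f K x by simpa [hφ x hx] using this
  refine (mem_farMap_iff hKU hx).2 ⟨hc, fun s hs => ?_⟩
  by_contra! hlt
  have hs' : ContinuousAt (fun p : EuclideanSpace ℝ (Fin J) × EuclideanSpace ℝ (Fin J) =>
      bregmanReal f p.1 s) (x, c) :=
    ContinuousAt.comp (f := fun p : EuclideanSpace ℝ (Fin J) × EuclideanSpace ℝ (Fin J) =>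
      (p.1, s)) (hf.continuousAt_bregmanReal hx (hKU hs)) (by fun_prop)
  have hev := (hf.continuousAt_bregmanReal hx (hKU hc)).eventually_lt hs' hlt
  rw [nhds_prod_eq] at hev
  obtain ⟨p, hp, q, hq, hpq⟩ := eventually_prod_iff.1 hev
  have hfreq : ∃ᶠ z in 𝓝[intDom f] x, q (φ z) := hcl.frequently hq
  obtain ⟨z, hqz, hpz, hz⟩ := (hfreq.and_eventually
    ((hp.filter_mono nhdsWithin_le_nhds).and self_mem_nhdsWithin)).exists
  exact absurd (hpq hpz hqz) ((hmem z hz).2 s hs).not_gt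

/-- A continuous selection of farthest points determines the gradient of `f` at every farthest
point: a convex function whose subdifferential has a continuous selection is differentiable. -/
theorem IsLegendre.gradient_eq_of_farthest (hf : IsLegendre f)
    {K : Set (EuclideanSpace ℝ (Fin J))} (hKU : K ⊆ intDom f)
    {φ : EuclideanSpace ℝ (Fin J) → EuclideanSpace ℝ (Fin J)}
    (hφ : ∀ x ∈ intDom f, φ x ∈ farMap f K x) (hcont : ContinuousOn φ (intDom f))
    {x c : EuclideanSpace ℝ (Fin J)} (hx : x ∈ intDom f) (hc : c ∈ farMap f K x) :
    egrad f c = egrad f (φ x) := by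
  have hmem : ∀ x ∈ intDom f, φ x ∈ K ∧ ∀ s ∈ K, bregmanReal f x s ≤ bregmanReal f x (φ x) :=
    fun x hx => (mem_farMap_iff hKU hx).1 (hφ x hx)
  rw [mem_farMap_iff hKU hx] at hc
  have hmono : ∀ z ∈ intDom f, inner ℝ (egrad f (φ z) - egrad f c) (z - x) ≤ 0 := by
    intro z hz
    have h1 := (hmem z hz).2 c hc.1
    have h2 := hc.2 (φ z) (hmem z hz).1
    simp only [bregmanReal, inner_sub_left, inner_sub_right] at h1 h2 ⊢
    linarith
  set h := egrad f (φ x) - egrad f c with hh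
  have hline : Tendsto (fun t : ℝ => x + t • h) (𝓝[>] 0) (𝓝 x) := by
    have : Continuous fun t : ℝ => x + t • h := by fun_prop
    simpa using (this.tendsto 0).mono_left nhdsWithin_le_nhds
  have hU := isOpen_intDom.mem_nhds hx
  have hGφ : ContinuousAt (fun z => egrad f (φ z)) x :=
    ContinuousAt.comp (g := egrad f)
      (hf.continuousOn_egrad.continuousAt (isOpen_intDom.mem_nhds (hKU (hmem x hx).1)))
      (hcont.continuousAt hU)
  have hlim : Tendsto (fun t : ℝ => inner ℝ (egrad f (φ (x + t • h)) - egrad f c) h) (𝓝[>] 0)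
      (𝓝 (inner ℝ h h)) :=
    ((hGφ.tendsto.comp hline).sub_const (egrad f c)).inner tendsto_const_nhds
  have hle : inner ℝ h h ≤ (0 : ℝ) := by
    refine le_of_tendsto hlim ?_
    filter_upwards [hline.eventually hU, self_mem_nhdsWithin] with t ht ht0
    have := hmono _ ht
    rw [add_sub_cancel_left, inner_smul_right] at this
    exact nonpos_of_mul_nonpos_right this ht0
  exact (sub_eq_zero.1 (real_inner_self_nonpos.1 hle)).symm

end BregmanKlee

theorem mainTheorem7 {J : ℕ} (f : EuclideanSpace ℝ (Fin J) → EReal)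
    (hf : BregmanKlee.IsLegendre f)
    (C : Set (EuclideanSpace ℝ (Fin J))) (hne : C.Nonempty)
    (hC : C ⊆ BregmanKlee.intDom f)
    (hcompact : IsCompact (closure C)) (hclosure : closure C ⊆ BregmanKlee.intDom f)
    (hdom : BregmanKlee.intDom f ⊆ BregmanKlee.svDom (BregmanKlee.farMap f C)) :
    BregmanKlee.IsKlee f (closure C) ↔
      BregmanKlee.IsKlee f C ∧
        BregmanKlee.SVContinuousOn (BregmanKlee.farMap f C) (BregmanKlee.intDom f) := by
  constructor
  · intro hK
    choose! φ hφ using hK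
    have hφC : ∀ x ∈ BregmanKlee.intDom f, BregmanKlee.farMap f C x = {φ x} := fun x hx =>
      (Set.Nonempty.subset_singleton_iff (hdom hx)).1
        (hφ x hx ▸ hf.farMap_subset_farMap_closure hclosure hx)
    exact ⟨fun x hx => ⟨φ x, hφC x hx⟩, φ, hφC,
      hf.continuousOn_of_unique_farthest hcompact hclosure hφ⟩
  · rintro ⟨-, φ, hφ, hcont⟩ x hx
    have hmem : ∀ z ∈ BregmanKlee.intDom f, φ z ∈ BregmanKlee.farMap f (closure C) z :=
      fun z hz => hf.farMap_subset_farMap_closure hclosure hz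
        (by rw [hφ z hz]; exact mem_singleton _)
    refine ⟨φ x, Set.eq_singleton_iff_unique_mem.2 ⟨hmem x hx, fun c hc => ?_⟩⟩
    exact hf.injOn_egrad (hclosure hc.2.1) (hclosure (hmem x hx).2.1)
      (hf.gradient_eq_of_farthest hclosure hmem hcont hx hc)
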